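/- Let $n\ge 1$ and let $D\subset\mathbb{C}^n$ be a domain (a nonempty connected open set) that is bounded and smoothly bounded, i.e. there are an open neighborhood $V$ of the boundary $bD$ and a function $\rho\in C^\infty(V;\mathbb{R})$ such that $d\rho\neq 0$ on $bD$ and $D\cap V=\{z\in V:\rho(z)<0\}$. Let $\lambda$ be the $2n$-dimensional Lebesgue measure on $\mathbb{C}^n$, let $A^2(D)$ be the closed subspace of $L^2(D)=L^2(D,\lambda)$ of square-integrable holomorphic functions on $D$, and let the Bergman projection $B_D$ be the orthogonal projection of $L^2(D)$ onto $A^2(D)$. Then $B_D$ is unbounded on $L^1$: there is no finite constant $C$ such that \[ \|B_D f\|_{L^1(D)}\le C\,\|f\|_{L^1(D)}\qquad\text{for all } f\in L^2(D)\cap L^1(D). \] -/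

import Mathlib

namespace Bergman

open MeasureTheory TopologicalSpace Filter Topology
open scoped ContDiff

/-! `ℂⁿ` is `Fin n → ℂ`; its `volume` is the standard `2n`-dimensional Lebesgue measure (the
product of the planar Lebesgue measures). -/

/-- `D` admits a smooth defining function: a smooth real function `ρ` on an open neighbourhood `V`
of the boundary of `D` such that `dρ ≠ 0` on the boundary and `D ∩ V = {ρ < 0}`. -/
def IsSmoothlyBounded {n : ℕ} (D : Set (Fin n → ℂ)) : Prop :=
  ∃ (V : Set (Fin n → ℂ)) (ρ : (Fin n → ℂ) → ℝ),
    IsOpen V ∧ frontier D ⊆ V ∧ ContDiffOn ℝ ∞ ρ V ∧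
    (∀ z ∈ frontier D, fderiv ℝ ρ z ≠ 0) ∧ D ∩ V = {z ∈ V | ρ z < 0}

/-- The a priori bound `‖P f‖_p ≤ C ‖f‖_p` for all `f ∈ L² ∩ L^p`, for some finite `C`. -/
def IsBoundedOnLp {X : Type*} [MeasurableSpace X] {μ : Measure X}
    (P : Lp ℂ 2 μ →L[ℂ] Lp ℂ 2 μ) (p : ENNReal) : Prop :=
  ∃ C : NNReal, ∀ f : Lp ℂ 2 μ, MemLp f p μ → eLpNorm (P f) p μ ≤ C * eLpNorm f p μ

/-- Mean value inequality for holomorphic functions on polydiscs. -/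
theorem enorm_mul_volume_ball_le {n : ℕ} {f : (Fin n → ℂ) → ℂ} {z : Fin n → ℂ} {r : ℝ}
    (hf : DifferentiableOn ℂ f (Metric.ball z r)) :
    ‖f z‖ₑ * volume (Metric.ball (0 : Fin n → ℂ) r) ≤ ∫⁻ w in Metric.ball z r, ‖f w‖ₑ := by
  set g : (Fin n → ℂ) → ℂ := (Metric.ball z r).indicator f with hg
  have hgm : Measurable g := by
    classical
    rw [hg, ← Set.piecewise_eq_indicator]
    exact hf.continuousOn.measurable_piecewise continuousOn_const measurableSet_ball
  have hmean : ∀ w ∈ Metric.ball (0 : Fin n → ℂ) r, ‖f z‖ₑ ≤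
      ENNReal.ofReal (2 * Real.pi)⁻¹ *
        ∫⁻ θ in Set.Ioc 0 (2 * Real.pi), ‖g (z + circleMap 0 1 θ • w)‖ₑ := by
    intro w hw
    have hw' : ‖w‖ < r := by simpa using hw
    have hmem : ∀ ζ : ℂ, ‖ζ‖ ≤ 1 → z + ζ • w ∈ Metric.ball z r := by
      intro ζ hζ
      rw [Metric.mem_ball, dist_eq_norm, add_sub_cancel_left, norm_smul]
      nlinarith [norm_nonneg w, norm_nonneg ζ]
    have hd : DifferentiableOn ℂ (fun ζ : ℂ => f (z + ζ • w)) (Metric.closedBall 0 1) := by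
      apply hf.comp (g := f) (f := fun ζ : ℂ => z + ζ • w)
      · fun_prop
      · intro ζ hζ
        exact hmem ζ (by simpa using hζ)
    have hc := circleAverage_of_differentiable_on_off_countable (f := fun ζ : ℂ => f (z + ζ • w))
      (c := 0) (R := 1) (s := ∅) Set.countable_empty (by simpa using hd.continuousOn)
      (fun ζ hζ => (hd ζ (Metric.ball_subset_closedBall (by simpa using hζ))).differentiableAt
        (Metric.closedBall_mem_nhds_of_mem (by simpa using hζ)))
    simp only [zero_smul, add_zero] at hc
    rw [← hc, Real.circleAverage_def, enorm_smul, intervalIntegral.integral_of_le (by positivity)]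
    rw [Real.enorm_of_nonneg (by positivity)]
    gcongr
    refine (enorm_integral_le_lintegral_enorm _).trans (le_of_eq ?_)
    congr 1 with θ
    rw [hg, Set.indicator_of_mem (hmem _ (by simp))]
  have hrot : ∀ θ : ℝ, ∫⁻ w in Metric.ball (0 : Fin n → ℂ) r, ‖g (z + circleMap 0 1 θ • w)‖ₑ =
      ∫⁻ w in Metric.ball z r, ‖f w‖ₑ := by
    intro θ
    have hp : MeasurePreserving (fun w : Fin n → ℂ => circleMap 0 1 θ • w) volume volume := by
      refine volume_preserving_pi (f := fun _ w => circleMap 0 1 θ * w) fun _ => ?_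
      have h : (fun w : ℂ => circleMap 0 1 θ * w) = rotation (Circle.exp θ) := by
        funext w
        simp [circleMap, rotation_apply]
      rw [h]
      exact (rotation (Circle.exp θ)).measurePreserving
    have hp2 : MeasurePreserving (fun w : Fin n → ℂ => z + circleMap 0 1 θ • w) volume volume :=
      (measurePreserving_add_left volume z).comp hp
    have hpre : (fun w : Fin n → ℂ => z + circleMap 0 1 θ • w) ⁻¹' Metric.ball z r =
        Metric.ball 0 r := by
      ext w; simp [norm_smul]
    rw [← hpre, hp2.setLIntegral_comp_preimage measurableSet_ball (f := fun w => ‖g w‖ₑ)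
      hgm.enorm]
    refine setLIntegral_congr_fun measurableSet_ball fun w hw => ?_
    simp only [hg, Set.indicator_of_mem hw]
  have hjm : Measurable (fun p : (Fin n → ℂ) × ℝ => ‖g (z + circleMap 0 1 p.2 • p.1)‖ₑ) := by
    refine (hgm.comp ?_).enorm
    have : Continuous (fun p : (Fin n → ℂ) × ℝ => z + circleMap 0 1 p.2 • p.1) := by
      have := continuous_circleMap 0 1
      fun_prop
    exact this.measurable
  calc ‖f z‖ₑ * volume (Metric.ball (0 : Fin n → ℂ) r)
      = ∫⁻ w in Metric.ball (0 : Fin n → ℂ) r, ‖f z‖ₑ := by simp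
    _ ≤ ∫⁻ w in Metric.ball (0 : Fin n → ℂ) r, ENNReal.ofReal (2 * Real.pi)⁻¹ *
        ∫⁻ θ in Set.Ioc 0 (2 * Real.pi), ‖g (z + circleMap 0 1 θ • w)‖ₑ :=
        setLIntegral_mono' measurableSet_ball hmean
    _ = ENNReal.ofReal (2 * Real.pi)⁻¹ * ∫⁻ w in Metric.ball (0 : Fin n → ℂ) r,
        ∫⁻ θ in Set.Ioc 0 (2 * Real.pi), ‖g (z + circleMap 0 1 θ • w)‖ₑ := by
        rw [lintegral_const_mul' _ _ ENNReal.ofReal_ne_top]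
    _ = ENNReal.ofReal (2 * Real.pi)⁻¹ * ∫⁻ θ in Set.Ioc 0 (2 * Real.pi),
        ∫⁻ w in Metric.ball (0 : Fin n → ℂ) r, ‖g (z + circleMap 0 1 θ • w)‖ₑ := by
        rw [lintegral_lintegral_swap hjm.aemeasurable]
    _ = ∫⁻ w in Metric.ball z r, ‖f w‖ₑ := by
        simp only [hrot, lintegral_const, Measure.restrict_apply MeasurableSet.univ,
          Set.univ_inter, Real.volume_Ioc, sub_zero]
        rw [mul_comm, mul_assoc, ← ENNReal.ofReal_mul (by positivity),
          mul_inv_cancel₀ (by positivity), ENNReal.ofReal_one, mul_one]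

/-- The Bergman space `A²(D)`: square-integrable functions on the open set `D` (for the
`2n`-dimensional Lebesgue measure) that are represented by a function holomorphic on `D`. -/
def bergmanSpace {n : ℕ} (D : Opens (Fin n → ℂ)) :
    Submodule ℂ (Lp ℂ 2 (volume.restrict (D : Set (Fin n → ℂ)))) where
  carrier := {f | ∃ g : (Fin n → ℂ) → ℂ, DifferentiableOn ℂ g D ∧
    f =ᵐ[volume.restrict (D : Set (Fin n → ℂ))] g}
  zero_mem' := ⟨0, differentiableOn_const 0, Lp.coeFn_zero _ _ _⟩
  add_mem' := by
    rintro f₁ f₂ ⟨g₁, hg₁, h₁⟩ ⟨g₂, hg₂, h₂⟩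
    exact ⟨g₁ + g₂, hg₁.add hg₂, (Lp.coeFn_add f₁ f₂).trans (h₁.add h₂)⟩
  smul_mem' := by
    rintro c f ⟨g, hg, h⟩
    exact ⟨c • g, hg.const_smul c, (Lp.coeFn_smul c f).trans (h.const_smul c)⟩

/-- Point evaluations are bounded on the Bergman space. -/
theorem norm_le_of_mem {n : ℕ} {D : Opens (Fin n → ℂ)} {r : ℝ} (hr : 0 < r) :
    ∃ C : ℝ, 0 ≤ C ∧ ∀ (F : Lp ℂ 2 (volume.restrict (D : Set (Fin n → ℂ))))
      (g : (Fin n → ℂ) → ℂ), DifferentiableOn ℂ g D →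
      F =ᵐ[volume.restrict (D : Set (Fin n → ℂ))] g →
      ∀ z, Metric.ball z r ⊆ D → ‖g z‖ ≤ C * ‖F‖ := by
  set v := volume (Metric.ball (0 : Fin n → ℂ) r) with hv
  have hv0 : 0 < v := Metric.measure_ball_pos _ _ hr
  have hvt : v ≠ ⊤ := measure_ball_lt_top.ne
  have hvr : 0 < v.toReal := ENNReal.toReal_pos hv0.ne' hvt
  refine ⟨(Real.sqrt v.toReal)⁻¹, by positivity, fun F g hg hFg z hz => ?_⟩
  have h1 := enorm_mul_volume_ball_le (f := fun w => g w ^ 2) (z := z) (r := r)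
    ((hg.mono hz).pow 2)
  have h2 : ∫⁻ w in Metric.ball z r, ‖g w ^ 2‖ₑ ≤ ‖F‖ₑ ^ 2 := by
    calc ∫⁻ w in Metric.ball z r, ‖g w ^ 2‖ₑ
        ≤ ∫⁻ w in (D : Set (Fin n → ℂ)), ‖g w ^ 2‖ₑ := lintegral_mono_set hz
      _ = ∫⁻ w in (D : Set (Fin n → ℂ)), ‖F w‖ₑ ^ (2 : ℝ) := by
          refine lintegral_congr_ae ?_
          filter_upwards [hFg] with w hw
          rw [hw, enorm_pow]
          norm_cast
      _ = ‖F‖ₑ ^ 2 := by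
          rw [Lp.enorm_def, eLpNorm_eq_lintegral_rpow_enorm_toReal (by norm_num) (by norm_num)]
          rw [← ENNReal.rpow_natCast, ← ENNReal.rpow_mul]
          norm_num
  have h3 := h1.trans h2
  rw [enorm_pow] at h3
  have h4 := ENNReal.toReal_mono (by finiteness) h3
  rw [ENNReal.toReal_mul, ENNReal.toReal_pow, ENNReal.toReal_pow, toReal_enorm, toReal_enorm]
    at h4
  have h5 : 0 < Real.sqrt v.toReal := Real.sqrt_pos.2 hvr
  rw [inv_mul_eq_div, le_div_iff₀ h5]
  refine le_of_sq_le_sq ?_ (norm_nonneg _)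
  rw [mul_pow, Real.sq_sqrt hvr.le]
  exact h4

/-- The Bergman space is closed in `L²(D)`, so that the orthogonal projection exists. -/
theorem isClosed_bergmanSpace {n : ℕ} (D : Opens (Fin n → ℂ)) :
    IsClosed (bergmanSpace D : Set (Lp ℂ 2 (volume.restrict (D : Set (Fin n → ℂ))))) := by
  rw [← isSeqClosed_iff_isClosed]
  intro F f hF hlim
  choose g hg hFg using hF
  have hcau := Metric.cauchySeq_iff.1 hlim.cauchySeq
  have hsub : ∀ k l, (F k - F l : Lp ℂ 2 (volume.restrict (D : Set (Fin n → ℂ))))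
      =ᵐ[volume.restrict (D : Set (Fin n → ℂ))] g k - g l := fun k l =>
    (Lp.coeFn_sub _ _).trans ((hFg k).sub (hFg l))
  have hloc : ∀ x ∈ D, ∃ r > 0, Metric.ball x r ⊆ D ∧
      UniformCauchySeqOn g atTop (Metric.ball x r) ∧
      UniformCauchySeqOn (fun k => fderiv ℂ (g k)) atTop (Metric.ball x r) := by
    intro x hx
    obtain ⟨ε, hε, hball⟩ := Metric.isOpen_iff.1 D.isOpen x hx
    obtain ⟨C, hC, hbd⟩ := norm_le_of_mem (D := D) (r := ε / 3) (by positivity)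
    have hb : ∀ k l, ∀ y ∈ Metric.ball x (2 * ε / 3), ‖g k y - g l y‖ ≤ C * ‖F k - F l‖ := by
      intro k l y hy
      refine hbd _ _ ((hg k).sub (hg l)) (hsub k l) y ?_
      refine (Metric.ball_subset_ball' ?_).trans hball
      rw [Metric.mem_ball] at hy
      linarith
    have hb' : ∀ k l, ∀ y ∈ Metric.ball x (ε / 3),
        ‖fderiv ℂ (g k) y - fderiv ℂ (g l) y‖ ≤ 2 * (C * ‖F k - F l‖) / (ε / 3) := by
      intro k l y hy
      have hyb : Metric.ball y (ε / 3) ⊆ Metric.ball x (2 * ε / 3) := by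
        refine Metric.ball_subset_ball' ?_
        rw [Metric.mem_ball] at hy
        linarith
      have hyD : Metric.ball y (ε / 3) ⊆ D :=
        hyb.trans ((Metric.ball_subset_ball (by linarith)).trans hball)
      have hyy : y ∈ Metric.ball y (ε / 3) := Metric.mem_ball_self (by positivity)
      have hd : ∀ m, DifferentiableAt ℂ (g m) y := fun m =>
        (hg m y (hyD hyy)).differentiableAt (D.isOpen.mem_nhds (hyD hyy))
      rw [← fderiv_sub (hd k) (hd l)]
      refine Complex.norm_fderiv_le_div_of_mapsTo_ball
        (((hg k).sub (hg l)).mono hyD) ?_ (by positivity)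
      intro w hw
      rw [mem_closedBall_iff_norm]
      refine (norm_sub_le _ _).trans ?_
      have e1 := hb k l w (hyb hw)
      have e2 := hb k l y (hyb hyy)
      simp only [Pi.sub_apply]
      linarith
    refine ⟨ε / 3, by positivity, (Metric.ball_subset_ball (by linarith)).trans hball, ?_, ?_⟩
    · rw [Metric.uniformCauchySeqOn_iff]
      intro η hη
      obtain ⟨N, hN⟩ := hcau (η / (C + 1)) (by positivity)
      refine ⟨N, fun k hk l hl y hy => ?_⟩
      have e1 := hb k l y (Metric.ball_subset_ball (by linarith) hy)
      have e2 := hN k hk l hl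
      rw [dist_eq_norm] at e2 ⊢
      rw [lt_div_iff₀ (by positivity)] at e2
      nlinarith [norm_nonneg (F k - F l)]
    · rw [Metric.uniformCauchySeqOn_iff]
      intro η hη
      obtain ⟨N, hN⟩ := hcau (η * (ε / 3) / (2 * C + 1)) (by positivity)
      refine ⟨N, fun k hk l hl y hy => ?_⟩
      have e1 := hb' k l y hy
      have e2 := hN k hk l hl
      rw [dist_eq_norm] at e2 ⊢
      rw [lt_div_iff₀ (by positivity)] at e2
      refine e1.trans_lt ?_
      rw [div_lt_iff₀ (by positivity)]
      rcases (norm_nonneg (F k - F l)).eq_or_lt with h0 | h0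
      · rw [← h0]; simp; positivity
      · nlinarith
  have hpt : ∀ x ∈ D, ∃ y, Tendsto (fun k => g k x) atTop (𝓝 y) := by
    intro x hx
    obtain ⟨r, hr, -, h1, -⟩ := hloc x hx
    exact cauchySeq_tendsto_of_complete (h1.cauchySeq (Metric.mem_ball_self hr))
  have hpt' : ∀ x ∈ D, ∃ y, Tendsto (fun k => fderiv ℂ (g k) x) atTop (𝓝 y) := by
    intro x hx
    obtain ⟨r, hr, -, -, h1⟩ := hloc x hx
    exact cauchySeq_tendsto_of_complete (h1.cauchySeq (Metric.mem_ball_self hr))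
  choose! G hG using hpt
  choose! G' hG' using hpt'
  refine ⟨G, fun x hx => ?_, ?_⟩
  · obtain ⟨r, hr, hrD, -, h2⟩ := hloc x hx
    have h3 := h2.tendstoUniformlyOn_of_tendsto fun y hy => hG' y (hrD hy)
    refine (hasFDerivAt_of_tendstoUniformlyOn Metric.isOpen_ball h3 (fun k y hy => ?_)
      (fun y hy => hG y (hrD hy))
      (Metric.mem_ball_self hr)).differentiableAt.differentiableWithinAt
    exact ((hg k y (hrD hy)).differentiableAt (D.isOpen.mem_nhds (hrD hy))).hasFDerivAt
  · obtain ⟨ns, hns, hae⟩ := (tendstoInMeasure_of_tendsto_Lp hlim).exists_seq_tendsto_ae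
    filter_upwards [hae, ae_all_iff.2 hFg, ae_restrict_mem D.isOpen.measurableSet]
      with x hx hgx hxD
    refine tendsto_nhds_unique hx ?_
    simp only [hgx]
    exact (hG x hxD).comp hns.tendsto_atTop

instance {n : ℕ} (D : Opens (Fin n → ℂ)) : (bergmanSpace D).HasOrthogonalProjection :=
  haveI := (isClosed_bergmanSpace D).completeSpace_coe
  inferInstance

/-- The Bergman projection `B_D`: the orthogonal projection of `L²(D)` with range `A²(D)`. -/
noncomputable def bergmanProjection {n : ℕ} (D : Opens (Fin n → ℂ)) :
    Lp ℂ 2 (volume.restrict (D : Set (Fin n → ℂ))) →L[ℂ]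
      Lp ℂ 2 (volume.restrict (D : Set (Fin n → ℂ))) :=
  (bergmanSpace D).starProjection

end Bergman

/-!
Let `p` be a point of `closure D` farthest from the origin. There is a `ℂ`-linear form `l` with
`‖z - p‖ ^ 2 ≤ Re (l (p - z))` on `D`, so the functions `log (l (p - z) + δ)`, `0 < δ ≤ 1`, are
bounded and holomorphic on `D`, but they blow up at `p` as `δ → 0`. Nevertheless their pairings with
a holomorphic function `f` are bounded by `‖f‖₁` uniformly in `δ`: integrate by parts against a
function `φ` that is positive near `p` in `D`, vanishes on the boundary and has nonzero differential
at `p`. The `∂̄`-operator kills `f` and falls on the conjugate of the logarithm, whose derivative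
`O(1 / |l (p - z) + δ|)` is compensated by `φ`. If the Bergman projection were bounded on `L¹`,
testing against projections of indicator functions would bound `-log |l (p - z) + δ|` on `D`,
uniformly in `δ`.
-/

namespace Bergman

open MeasureTheory TopologicalSpace Filter Topology
open scoped ContDiff ComplexConjugate

section Holomorphic

variable {E F : Type*} [NormedAddCommGroup E] [NormedSpace ℂ E] [NormedAddCommGroup F]
  [NormedSpace ℂ F] {f : E → F} {U : Set E}

theorem dist_le_of_mapsTo_closedBall {x y : E} {c : F} {r M : ℝ}
    (hf : DifferentiableOn ℂ f (Metric.ball x r))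
    (hM : Set.MapsTo f (Metric.ball x r) (Metric.closedBall c M)) (hy : y ∈ Metric.ball x r) :
    dist (f y) (f x) ≤ 2 * M / r * dist y x := by
  refine Complex.dist_le_div_mul_dist_of_mapsTo_ball hf (fun u hu => ?_) hy
  have hu' := hM hu
  have hx := hM (Metric.mem_ball_self (Metric.pos_of_mem_ball hy))
  rw [Metric.mem_closedBall] at hu' hx ⊢
  linarith [dist_triangle_right (f u) (f x) c]

/-- The Cauchy estimate for the difference `fun w => f (w + (y - x)) - f w`, which is itself small
by the Cauchy estimate for `f`. -/
theorem dist_fderiv_le_of_mapsTo_closedBall {x y : E} {c : F} {r M : ℝ}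
    (hf : DifferentiableOn ℂ f (Metric.ball x (2 * r)))
    (hM : Set.MapsTo f (Metric.ball x (2 * r)) (Metric.closedBall c M))
    (hy : y ∈ Metric.ball x r) :
    dist (fderiv ℂ f y) (fderiv ℂ f x) ≤ 4 * M / r ^ 2 * dist y x := by
  have hr : 0 < r := Metric.pos_of_mem_ball hy
  set h := y - x
  have hh : ‖h‖ < r := by rwa [← dist_eq_norm]
  have hball : ∀ w ∈ Metric.ball x r, Metric.ball w r ⊆ Metric.ball x (2 * r) := fun w hw =>
    Metric.ball_subset_ball' (by linarith [Metric.mem_ball.1 hw])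
  have hshift : ∀ w, w + h ∈ Metric.ball w r := fun w => by simpa using hh
  set g : E → F := fun w => f (w + h) - f w
  have hg_le : ∀ w ∈ Metric.ball x r, ‖g w‖ ≤ 2 * M / r * ‖h‖ := fun w hw => by
    simpa [dist_eq_norm] using dist_le_of_mapsTo_closedBall (hf.mono (hball w hw))
      (hM.mono_left (hball w hw)) (hshift w)
  have hx : x ∈ Metric.ball x r := Metric.mem_ball_self hr
  have hfw : ∀ w ∈ Metric.ball x (2 * r), DifferentiableAt ℂ f w := fun w hw =>
    hf.differentiableAt (Metric.isOpen_ball.mem_nhds hw)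
  have hgw : ∀ w ∈ Metric.ball x r, HasFDerivAt g (fderiv ℂ f (w + h) - fderiv ℂ f w) w :=
    fun w hw => ((hasFDerivAt_comp_add_right h).2 (hfw _ (hball w hw (hshift w))).hasFDerivAt).sub
      (hfw w (hball w hw (Metric.mem_ball_self hr))).hasFDerivAt
  have hcauchy := Complex.norm_fderiv_le_div_of_mapsTo_ball (f := g) (R₂ := 4 * M / r * ‖h‖)
    (fun w hw => (hgw w hw).differentiableAt.differentiableWithinAt)
    (fun w hw => by
      rw [mem_closedBall_iff_norm]
      calc ‖g w - g x‖ ≤ 2 * M / r * ‖h‖ + 2 * M / r * ‖h‖ :=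
            norm_sub_le_of_le (hg_le w hw) (hg_le x hx)
        _ = 4 * M / r * ‖h‖ := by ring) hr
  rw [(hgw x hx).fderiv, show x + h = y from add_sub_cancel x y] at hcauchy
  rw [dist_eq_norm, dist_eq_norm]
  calc ‖fderiv ℂ f y - fderiv ℂ f x‖ ≤ 4 * M / r * ‖h‖ / r := hcauchy
    _ = 4 * M / r ^ 2 * ‖h‖ := by field_simp

theorem continuousOn_fderiv_of_differentiableOn (hU : IsOpen U) (hf : DifferentiableOn ℂ f U) :
    ContinuousOn (fderiv ℂ f) U := by
  refine hU.continuousOn_iff.2 fun x hx => ?_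
  have hev : ∀ᶠ y in 𝓝 x, y ∈ U ∧ f y ∈ Metric.closedBall (f x) 1 :=
    (hU.eventually_mem hx).and
      ((hf.continuousOn.continuousAt (hU.mem_nhds hx)).eventually
        (Metric.closedBall_mem_nhds _ one_pos))
  obtain ⟨ε, hε, hball⟩ := Metric.eventually_nhds_iff_ball.1 hev
  have hε2 : 2 * (ε / 2) = ε := mul_div_cancel₀ ε two_ne_zero
  refine continuousAt_of_locally_lipschitz (half_pos hε) (4 * 1 / (ε / 2) ^ 2) fun y hy =>
    dist_fderiv_le_of_mapsTo_closedBall (c := f x) (fun z hz => ?_) (fun z hz => ?_) hy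
  · exact (hf z (hball z (hε2 ▸ hz)).1).differentiableAt
      (hU.mem_nhds (hball z (hε2 ▸ hz)).1) |>.differentiableWithinAt
  · exact (hball z (hε2 ▸ hz)).2

theorem contDiffOn_one_of_differentiableOn (hU : IsOpen U) (hf : DifferentiableOn ℂ f U) :
    ContDiffOn ℂ 1 f U := by
  rw [← zero_add (1 : WithTop ℕ∞), contDiffOn_succ_iff_fderiv_of_isOpen hU]
  exact ⟨hf, by simp, contDiffOn_zero.2 (continuousOn_fderiv_of_differentiableOn hU hf)⟩

end Holomorphic

section CauchyRiemann

variable {E : Type*} [NormedAddCommGroup E] [NormedSpace ℂ E]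

/-- Twice the Cauchy–Riemann operator along the complex line spanned by `v`: for `E = ℂⁿ` and `v`
the `j`-th basis vector it is `2 ∂/∂z̄ⱼ`. -/
noncomputable def dbar (v : E) (f : E → ℂ) (x : E) : ℂ :=
  fderiv ℝ f x v + Complex.I * fderiv ℝ f x (Complex.I • v)

variable {v x : E} {f g : E → ℂ}

theorem dbar_mul (hf : DifferentiableAt ℝ f x) (hg : DifferentiableAt ℝ g x) :
    dbar v (fun y => f y * g y) x = dbar v f x * g x + f x * dbar v g x := by
  simp only [dbar, fderiv_fun_mul hf hg, add_apply, smul_apply, smul_eq_mul]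
  ring

theorem dbar_eq_zero (hf : DifferentiableAt ℂ f x) : dbar v f x = 0 := by
  rw [dbar, hf.fderiv_restrictScalars ℝ]
  simp [← mul_assoc]

theorem dbar_conj (hf : DifferentiableAt ℂ f x) :
    dbar v (fun y => conj (f y)) x = 2 * conj (fderiv ℂ f x v) := by
  have h : HasFDerivAt (fun y => conj (f y))
      (Complex.conjCLE.toContinuousLinearMap.comp ((fderiv ℂ f x).restrictScalars ℝ)) x :=
    (Complex.conjCLE.toContinuousLinearMap.hasFDerivAt (x := f x)).comp x
      (hf.hasFDerivAt.restrictScalars ℝ)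
  rw [dbar, h.fderiv]
  simp [← mul_assoc, two_mul]

theorem hasFDerivAt_ofReal_comp {φ : E → ℝ} {φ' : E →L[ℝ] ℝ} (hφ : HasFDerivAt φ φ' x) :
    HasFDerivAt (fun y => (φ y : ℂ)) (Complex.ofRealCLM.comp φ') x :=
  Complex.ofRealCLM.hasFDerivAt.comp x hφ

theorem dbar_ofReal_comp {φ : E → ℝ} {m : ℝ → ℝ} {m' : ℝ} (hφ : DifferentiableAt ℝ φ x)
    (hm : HasDerivAt m m' (φ x)) :
    dbar v (fun y => (m (φ y) : ℂ)) x = m' * dbar v (fun y => (φ y : ℂ)) x := by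
  have hmφ : HasFDerivAt (fun y => m (φ y)) (m' • fderiv ℝ φ x) x :=
    hm.comp_hasFDerivAt x hφ.hasFDerivAt
  rw [dbar, dbar, (hasFDerivAt_ofReal_comp hφ.hasFDerivAt).fderiv,
    (hasFDerivAt_ofReal_comp hmφ).fderiv]
  simp only [ContinuousLinearMap.comp_apply, smul_apply, smul_eq_mul, Complex.ofRealCLM_apply,
    Complex.ofReal_mul]
  ring

theorem re_dbar_ofReal {φ : E → ℝ} (hφ : DifferentiableAt ℝ φ x) :
    (dbar v (fun y => (φ y : ℂ)) x).re = fderiv ℝ φ x v := by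
  simp [dbar, (hasFDerivAt_ofReal_comp hφ.hasFDerivAt).fderiv]

theorem dbar_ofReal_eq_zero {φ : E → ℝ} (hφ : HasFDerivAt φ (0 : E →L[ℝ] ℝ) x) :
    dbar v (fun y => (φ y : ℂ)) x = 0 := by
  simp [dbar, (hasFDerivAt_ofReal_comp hφ).fderiv]

theorem contDiff_dbar {n : ℕ∞} (hf : ContDiff ℝ (n + 1) f) (v : E) : ContDiff ℝ n (dbar v f) := by
  have h := hf.fderiv_right (m := n) le_rfl
  exact (h.clm_apply contDiff_const).add (contDiff_const.mul (h.clm_apply contDiff_const))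

theorem hasCompactSupport_dbar (hf : HasCompactSupport f) (v : E) :
    HasCompactSupport (dbar v f) :=
  (hf.fderiv_apply ℝ v).add ((hf.fderiv_apply ℝ (Complex.I • v)).mul_left)

theorem dbar_eq_zero_of_notMem_tsupport (hx : x ∉ tsupport f) : dbar v f x = 0 := by
  simp [dbar, fderiv_of_notMem_tsupport ℝ hx]

theorem continuousOn_dbar {U : Set E} (hU : IsOpen U) (hf : ContDiffOn ℝ 1 f U) (v : E) :
    ContinuousOn (dbar v f) U := by
  have h := hf.continuousOn_fderiv_of_isOpen hU le_rfl
  exact (h.clm_apply continuousOn_const).add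
    (continuousOn_const.mul (h.clm_apply continuousOn_const))

end CauchyRiemann

section IntegralDbar

theorem integral_fderiv_apply_eq_zero {E F : Type*} [NormedAddCommGroup E] [NormedSpace ℝ E]
    [FiniteDimensional ℝ E] [MeasurableSpace E] [BorelSpace E] {μ : Measure E}
    [μ.IsAddHaarMeasure] [NormedAddCommGroup F] [NormedSpace ℝ F] {f : E → F}
    (hf : ContDiff ℝ 1 f) (hc : HasCompactSupport f) (v : E) : ∫ x, fderiv ℝ f x v ∂μ = 0 := by
  have hint : Integrable (fun x => fderiv ℝ f x v) μ :=
    ((hf.continuous_fderiv one_ne_zero).clm_apply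
      continuous_const).integrable_of_hasCompactSupport (hc.fderiv_apply ℝ v)
  simpa using integral_smul_fderiv_eq_neg_fderiv_smul_of_integrable (μ := μ)
    (f := fun _ : E => (1 : ℝ)) (g := f) (v := v) (by simp) (by simpa using hint)
    (by simpa using hf.continuous.integrable_of_hasCompactSupport hc)
    (fun _ _ => differentiableAt_const _) (fun x _ => hf.differentiable one_ne_zero x)

theorem integrable_mul_of_tsupport_subset {X : Type*} [TopologicalSpace X] [MeasurableSpace X]
    [OpensMeasurableSpace X] {μ : Measure X} [IsFiniteMeasureOnCompacts μ] {U : Set X}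
    {χ f : X → ℂ} (hχ : Continuous χ) (hc : HasCompactSupport χ) (hχU : tsupport χ ⊆ U)
    (hf : ContinuousOn f U) : Integrable (fun x => χ x * f x) μ := by
  refine IntegrableOn.integrable_of_forall_notMem_eq_zero (s := tsupport χ) ?_ fun x hx => by
    rw [image_eq_zero_of_notMem_tsupport hx, zero_mul]
  exact (hχ.continuousOn.mul (hf.mono hχU)).integrableOn_compact' hc
    (isClosed_tsupport χ).measurableSet

variable {E : Type*} [NormedAddCommGroup E] [NormedSpace ℂ E] [FiniteDimensional ℂ E]
  [MeasurableSpace E] [BorelSpace E] {μ : Measure E} [μ.IsAddHaarMeasure] {U : Set E}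
  {χ f : E → ℂ}

theorem integral_dbar_eq_zero (hf : ContDiff ℝ 1 f) (hc : HasCompactSupport f) (v : E) :
    ∫ x, dbar v f x ∂μ = 0 := by
  have hint : ∀ w, Integrable (fun x => fderiv ℝ f x w) μ := fun w =>
    ((hf.continuous_fderiv one_ne_zero).clm_apply
      continuous_const).integrable_of_hasCompactSupport (hc.fderiv_apply ℝ w)
  simp only [dbar]
  rw [integral_add (hint _) ((hint _).const_mul _), integral_const_mul,
    integral_fderiv_apply_eq_zero hf hc, integral_fderiv_apply_eq_zero hf hc, mul_zero, add_zero]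

theorem integral_dbar_mul_eq_neg (hU : IsOpen U) (hχ : ContDiff ℝ 1 χ) (hc : HasCompactSupport χ)
    (hχU : tsupport χ ⊆ U) (hf : ContDiffOn ℝ 1 f U) (v : E) :
    ∫ x, dbar v χ x * f x ∂μ = -∫ x, χ x * dbar v f x ∂μ := by
  have hfx : ∀ x ∈ tsupport χ, ContDiffAt ℝ 1 f x := fun x hx =>
    hf.contDiffAt (hU.mem_nhds (hχU hx))
  have hprod : ContDiff ℝ 1 fun x => χ x * f x := by
    refine contMDiff_iff_contDiff.1 (contMDiff_of_tsupport fun x hx => ?_)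
    exact (hχ.contDiffAt.mul (hfx x (tsupport_mul_subset_left hx))).contMDiffAt
  have hleibniz : ∀ x, dbar v (fun y => χ y * f y) x = dbar v χ x * f x + χ x * dbar v f x := by
    intro x
    by_cases hx : x ∈ tsupport χ
    · exact dbar_mul (hχ.differentiable one_ne_zero x) ((hfx x hx).differentiableAt one_ne_zero)
    · rw [dbar_eq_zero_of_notMem_tsupport hx, image_eq_zero_of_notMem_tsupport hx,
        dbar_eq_zero_of_notMem_tsupport fun h => hx (tsupport_mul_subset_left h)]
      ring
  have hdχ : Continuous (dbar v χ) := (contDiff_dbar (n := 0) (by simpa using hχ) v).continuous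
  have hsub : tsupport (dbar v χ) ⊆ tsupport χ :=
    closure_minimal (fun x hx => by
      contrapose! hx
      simp [dbar_eq_zero_of_notMem_tsupport hx]) (isClosed_tsupport χ)
  have h1 : Integrable (fun x => dbar v χ x * f x) μ :=
    integrable_mul_of_tsupport_subset hdχ (hasCompactSupport_dbar hc v) (hsub.trans hχU)
      hf.continuousOn
  have h2 : Integrable (fun x => χ x * dbar v f x) μ :=
    integrable_mul_of_tsupport_subset hχ.continuous hc hχU (continuousOn_dbar hU hf v)
  have h0 := integral_dbar_eq_zero (μ := μ) hprod hc.mul_right v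
  simp only [hleibniz] at h0
  rwa [integral_add h1 h2, add_eq_zero_iff_eq_neg] at h0

end IntegralDbar

section Truncation

/-- A continuously differentiable approximation of the positive part: it vanishes on `(-∞, ε]`, and
its slope on `[0, ∞)` lies between `0` and `1` and is equal to `1` from `2 ε` on. -/
noncomputable def truncation (ε t : ℝ) : ℝ :=
  ∫ s in (0)..t, Real.smoothTransition (s / ε - 1)

variable {ε t : ℝ}

theorem continuous_smoothTransition_div_sub (ε : ℝ) :
    Continuous fun s => Real.smoothTransition (s / ε - 1) :=
  Real.smoothTransition.continuous.comp (by fun_prop)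

theorem hasDerivAt_truncation (ε t : ℝ) :
    HasDerivAt (truncation ε) (Real.smoothTransition (t / ε - 1)) t :=
  (continuous_smoothTransition_div_sub ε).integral_hasStrictDerivAt 0 t |>.hasDerivAt

theorem contDiff_truncation (ε : ℝ) : ContDiff ℝ 1 (truncation ε) := by
  refine contDiff_one_iff_deriv.2 ⟨fun t => (hasDerivAt_truncation ε t).differentiableAt, ?_⟩
  rw [deriv_eq (hasDerivAt_truncation ε)]
  exact continuous_smoothTransition_div_sub ε

theorem truncation_eq_zero (hε : 0 < ε) (ht : t ≤ ε) : truncation ε t = 0 := by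
  refine intervalIntegral.integral_zero_ae (ae_of_all _ fun s hs => ?_)
  refine Real.smoothTransition.zero_of_nonpos (sub_nonpos.2 ((div_le_one hε).2 ?_))
  exact hs.2.trans (max_le hε.le ht)

theorem abs_truncation_le (ε t : ℝ) : |truncation ε t| ≤ |t| := by
  simpa [truncation] using intervalIntegral.norm_integral_le_of_norm_le_const (a := 0) (b := t)
    (C := 1) (f := fun s => Real.smoothTransition (s / ε - 1)) fun s _ => by
      rw [Real.norm_of_nonneg (Real.smoothTransition.nonneg _)]
      exact Real.smoothTransition.le_one _

theorem tendsto_smoothTransition_div_sub (ht : 0 < t) :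
    Tendsto (fun ε => Real.smoothTransition (t / ε - 1)) (𝓝[>] 0) (𝓝 1) := by
  refine tendsto_const_nhds.congr' ?_
  filter_upwards [Ioo_mem_nhdsGT (half_pos ht)] with ε hε
  refine (Real.smoothTransition.one_of_one_le ?_).symm
  rw [le_sub_iff_add_le, le_div_iff₀ hε.1]
  linarith [hε.2]

variable {X : Type*} [TopologicalSpace X] {φ : X → ℝ}

theorem hasCompactSupport_truncation (hε : 0 < ε) (hc : HasCompactSupport φ) :
    HasCompactSupport fun x => (truncation ε (φ x) : ℂ) :=
  hc.comp_left (g := fun t => (truncation ε t : ℂ)) (by simp [truncation_eq_zero hε hε.le])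

theorem tsupport_truncation_subset (hε : 0 < ε) {s : Set X} (hφ : Continuous φ)
    (hφ_nonpos : ∀ x ∉ s, φ x ≤ 0) : tsupport (fun x => (truncation ε (φ x) : ℂ)) ⊆ s := by
  have hsub : tsupport (fun x => (truncation ε (φ x) : ℂ)) ⊆ {x | ε ≤ φ x} := by
    refine closure_minimal (fun x hx => ?_) (isClosed_le continuous_const hφ)
    contrapose! hx
    simp [truncation_eq_zero hε (not_le.1 hx).le]
  intro x hx
  by_contra hxs
  exact (hε.trans_le (hsub hx)).not_ge (hφ_nonpos x hxs)

end Truncation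

section IntegrationByParts

variable {E : Type*} [NormedAddCommGroup E] [NormedSpace ℂ E] [FiniteDimensional ℂ E]
  [MeasurableSpace E] [BorelSpace E] {μ : Measure E} [μ.IsAddHaarMeasure] {D : Set E}
  {φ : E → ℝ} {f : E → ℂ}

theorem norm_setIntegral_smoothTransition_mul_dbar_le {ε : ℝ} (hε : 0 < ε) (hD : IsOpen D)
    (hφ : ContDiff ℝ 1 φ) (hc : HasCompactSupport φ) (hφ_nonneg : ∀ x ∈ D, 0 ≤ φ x)
    (hφ_nonpos : ∀ x ∉ D, φ x ≤ 0) (hf : ContDiffOn ℝ 1 f D) (v : E)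
    (hint : IntegrableOn (fun x => φ x * ‖dbar v f x‖) D μ) :
    ‖∫ x in D, Real.smoothTransition (φ x / ε - 1) * dbar v (fun y => (φ y : ℂ)) x * f x ∂μ‖ ≤
      ∫ x in D, φ x * ‖dbar v f x‖ ∂μ := by
  have hparts := integral_dbar_mul_eq_neg (μ := μ) hD
    (Complex.ofRealCLM.contDiff.comp ((contDiff_truncation ε).comp hφ))
    (hasCompactSupport_truncation hε hc)
    (tsupport_truncation_subset hε hφ.continuous hφ_nonpos) hf v
  have hzero : ∀ x ∉ D, φ x / ε - 1 ≤ 0 := fun x hx => by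
    linarith [div_nonpos_of_nonpos_of_nonneg (hφ_nonpos x hx) hε.le]
  rw [setIntegral_eq_integral_of_forall_compl_eq_zero fun x hx => by
    simp [Real.smoothTransition.zero_of_nonpos (hzero x hx)]]
  simp only [← dbar_ofReal_comp (hφ.differentiable one_ne_zero _) (hasDerivAt_truncation ε _)]
  refine (congrArg norm hparts).trans_le ?_
  rw [norm_neg, ← setIntegral_eq_integral_of_forall_compl_eq_zero (s := D) fun x hx => by
    simp [truncation_eq_zero hε ((hφ_nonpos x hx).trans hε.le)]]
  refine norm_integral_le_of_norm_le hint ?_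
  filter_upwards [ae_restrict_mem hD.measurableSet] with x hx
  rw [norm_mul]
  gcongr
  simpa [abs_of_nonneg (hφ_nonneg x hx)] using abs_truncation_le ε (φ x)

/-- No boundary term appears because `φ` vanishes on the boundary of `D`. -/
theorem norm_setIntegral_dbar_mul_le (hD : IsOpen D)
    (hφ : ContDiff ℝ 1 φ) (hc : HasCompactSupport φ) (hφ_nonneg : ∀ x ∈ D, 0 ≤ φ x)
    (hφ_nonpos : ∀ x ∉ D, φ x ≤ 0) (hf : ContDiffOn ℝ 1 f D) (hf_int : IntegrableOn f D μ) (v : E)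
    (hint : IntegrableOn (fun x => φ x * ‖dbar v f x‖) D μ) :
    ‖∫ x in D, dbar v (fun y => (φ y : ℂ)) x * f x ∂μ‖ ≤ ∫ x in D, φ x * ‖dbar v f x‖ ∂μ := by
  set dφ := dbar v (fun y => (φ y : ℂ))
  have hφℂ : ContDiff ℝ 1 fun y => (φ y : ℂ) := Complex.ofRealCLM.contDiff.comp hφ
  have hdφ : Continuous dφ := (contDiff_dbar (n := 0) (by simpa using hφℂ) v).continuous
  obtain ⟨B, hB⟩ := (hasCompactSupport_dbar (hc.comp_left (g := fun t : ℝ => (t : ℂ))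
    Complex.ofReal_zero) v).exists_bound_of_continuous hdφ
  have hpointwise : ∀ x ∈ D, Tendsto
      (fun ε => (Real.smoothTransition (φ x / ε - 1) : ℂ) * dφ x * f x) (𝓝[>] 0)
      (𝓝 (dφ x * f x)) := by
    intro x hx
    rcases (hφ_nonneg x hx).eq_or_lt with hφx | hφx
    · have hmin : IsLocalMin φ x := by
        filter_upwards [hD.mem_nhds hx] with y hy
        exact hφx ▸ hφ_nonneg y hy
      have hdφx : dφ x = 0 := dbar_ofReal_eq_zero
        (hmin.fderiv_eq_zero ▸ (hφ.differentiable one_ne_zero x).hasFDerivAt)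
      simp [hdφx]
    · have h := (Complex.continuous_ofReal.tendsto 1).comp (tendsto_smoothTransition_div_sub hφx)
      simpa using (h.mul_const (dφ x)).mul_const (f x)
  refine le_of_tendsto (tendsto_integral_filter_of_dominated_convergence (fun x => B * ‖f x‖)
    ?_ ?_ (hf_int.norm.const_mul B)
    ((ae_restrict_mem hD.measurableSet).mono hpointwise)).norm
    (eventually_mem_nhdsWithin.mono fun ε hε => norm_setIntegral_smoothTransition_mul_dbar_le hε hD
      hφ hc hφ_nonneg hφ_nonpos hf v hint)
  · refine Eventually.of_forall fun ε => ((Continuous.mul ?_ hdφ).aestronglyMeasurable).mul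
      hf_int.aestronglyMeasurable
    exact Complex.continuous_ofReal.comp
      ((continuous_smoothTransition_div_sub ε).comp hφ.continuous)
  · refine Eventually.of_forall fun ε => ae_of_all _ fun x => ?_
    rw [norm_mul, norm_mul, Complex.norm_real,
      Real.norm_of_nonneg (Real.smoothTransition.nonneg _)]
    gcongr
    exact (mul_le_of_le_one_left (norm_nonneg _) (Real.smoothTransition.le_one _)).trans (hB x)

end IntegrationByParts

section WeightedPairing

theorem integrableOn_mul_conj {X : Type*} [TopologicalSpace X] [MeasurableSpace X]
    [OpensMeasurableSpace X] {μ : Measure X} {s : Set X} {f g : X → ℂ} {B : ℝ}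
    (hs : MeasurableSet s) (hf : IntegrableOn f s μ) (hg : ContinuousOn g s)
    (hgB : ∀ z ∈ s, ‖g z‖ ≤ B) : IntegrableOn (fun z => f z * conj (g z)) s μ := by
  refine hf.mul_bdd (c := B) ?_ ?_
  · exact (Complex.continuous_conj.comp_continuousOn hg).aestronglyMeasurable hs
  · filter_upwards [ae_restrict_mem hs] with z hz
    simpa using hgB z hz

variable {E : Type*} [NormedAddCommGroup E] [NormedSpace ℂ E] {D : Set E} {f g : E → ℂ} {v p : E}

theorem contDiffOn_mul_conj (hD : IsOpen D) (hf : DifferentiableOn ℂ f D)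
    (hg : DifferentiableOn ℂ g D) : ContDiffOn ℝ 1 (fun z => f z * conj (g z)) D :=
  ((contDiffOn_one_of_differentiableOn hD hf).restrict_scalars ℝ).mul
    (Complex.conjCLE.contDiff.comp_contDiffOn
      ((contDiffOn_one_of_differentiableOn hD hg).restrict_scalars ℝ))

theorem dbar_mul_conj {z : E} (hf : DifferentiableAt ℂ f z) (hg : DifferentiableAt ℂ g z) :
    dbar v (fun y => f y * conj (g y)) z = f z * (2 * conj (fderiv ℂ g z v)) := by
  rw [dbar_mul (hf.restrictScalars ℝ) ?_, dbar_eq_zero hf, dbar_conj hg, zero_mul, zero_add]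
  exact Complex.conjCLE.differentiableAt.comp z (hg.restrictScalars ℝ)

variable [FiniteDimensional ℂ E] [MeasurableSpace E] [BorelSpace E] {μ : Measure E}
  [μ.IsAddHaarMeasure] {φ : E → ℝ} {B Q R : ℝ}

theorem norm_setIntegral_dbar_mul_mul_conj_le (hD : IsOpen D) (hφ : ContDiff ℝ 1 φ)
    (hc : HasCompactSupport φ) (hφ_nonneg : ∀ x ∈ D, 0 ≤ φ x) (hφ_nonpos : ∀ x ∉ D, φ x ≤ 0)
    (hf : DifferentiableOn ℂ f D) (hf_int : IntegrableOn f D μ) (hg : DifferentiableOn ℂ g D)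
    (hgB : ∀ z ∈ D, ‖g z‖ ≤ B) (hgR : ∀ z ∈ D, φ z * ‖fderiv ℂ g z v‖ ≤ R) :
    ‖∫ z in D, dbar v (fun y => (φ y : ℂ)) z * (f z * conj (g z)) ∂μ‖ ≤
      2 * R * ∫ z in D, ‖f z‖ ∂μ := by
  have hF := contDiffOn_mul_conj hD hf hg
  have hbound : ∀ᵐ z ∂μ.restrict D,
      ‖φ z * ‖dbar v (fun y => f y * conj (g y)) z‖‖ ≤ 2 * R * ‖f z‖ := by
    filter_upwards [ae_restrict_mem hD.measurableSet] with z hz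
    rw [Real.norm_of_nonneg (mul_nonneg (hφ_nonneg z hz) (norm_nonneg _)),
      dbar_mul_conj (hf.differentiableAt (hD.mem_nhds hz)) (hg.differentiableAt (hD.mem_nhds hz)),
      norm_mul, norm_mul, RCLike.norm_conj, Complex.norm_ofNat]
    calc φ z * (‖f z‖ * (2 * ‖fderiv ℂ g z v‖)) = 2 * (φ z * ‖fderiv ℂ g z v‖) * ‖f z‖ := by ring
      _ ≤ 2 * R * ‖f z‖ := by gcongr; exact hgR z hz
  have hint : IntegrableOn (fun z => φ z * ‖dbar v (fun y => f y * conj (g y)) z‖) D μ :=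
    (hf_int.norm.const_mul (2 * R)).mono' ((hφ.continuous.continuousOn.mul
      (continuousOn_dbar hD hF v).norm).aestronglyMeasurable hD.measurableSet) hbound
  rw [← integral_const_mul]
  exact (norm_setIntegral_dbar_mul_le hD hφ hc hφ_nonneg hφ_nonpos hF
    (integrableOn_mul_conj hD.measurableSet hf_int hg.continuousOn hgB) v hint).trans
    (integral_mono_ae hint (hf_int.norm.const_mul (2 * R))
      (hbound.mono fun z hz => (le_abs_self _).trans hz))

/-- Near `p` the constant `dbar v φ p` differs from `dbar v φ` by a factor that absorbs the
singularity of `g` at `p`; integration by parts handles the remaining term. -/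
theorem norm_dbar_mul_norm_setIntegral_mul_conj_le {K : NNReal} (hD : IsOpen D)
    (hφ : ContDiff ℝ 1 φ) (hc : HasCompactSupport φ) (hφ_nonneg : ∀ x ∈ D, 0 ≤ φ x)
    (hφ_nonpos : ∀ x ∉ D, φ x ≤ 0) (hK : LipschitzWith K (dbar v fun y => (φ y : ℂ)))
    (hf : DifferentiableOn ℂ f D) (hf_int : IntegrableOn f D μ) (hg : DifferentiableOn ℂ g D)
    (hgB : ∀ z ∈ D, ‖g z‖ ≤ B) (hgQ : ∀ z ∈ D, ‖z - p‖ * ‖g z‖ ≤ Q)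
    (hgR : ∀ z ∈ D, φ z * ‖fderiv ℂ g z v‖ ≤ R) :
    ‖dbar v (fun y => (φ y : ℂ)) p‖ * ‖∫ z in D, f z * conj (g z) ∂μ‖ ≤
      (K * Q + 2 * R) * ∫ z in D, ‖f z‖ ∂μ := by
  set dφ := dbar v fun y => (φ y : ℂ)
  have hF_int := integrableOn_mul_conj (μ := μ) hD.measurableSet hf_int hg.continuousOn hgB
  obtain ⟨A, hA⟩ := (hasCompactSupport_dbar (hc.comp_left (g := fun t : ℝ => (t : ℂ))
    Complex.ofReal_zero) v).exists_bound_of_continuous hK.continuous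
  have hdφ_int : IntegrableOn (fun z => dφ z * (f z * conj (g z))) D μ :=
    hF_int.bdd_mul (c := A) hK.continuous.aestronglyMeasurable (ae_of_all _ hA)
  have hsing : ‖∫ z in D, (dφ p - dφ z) * (f z * conj (g z)) ∂μ‖ ≤
      K * Q * ∫ z in D, ‖f z‖ ∂μ := by
    rw [← integral_const_mul]
    refine norm_integral_le_of_norm_le (hf_int.norm.const_mul _) ?_
    filter_upwards [ae_restrict_mem hD.measurableSet] with z hz
    rw [norm_mul, norm_mul, RCLike.norm_conj]
    calc ‖dφ p - dφ z‖ * (‖f z‖ * ‖g z‖) ≤ K * ‖z - p‖ * (‖f z‖ * ‖g z‖) := by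
          gcongr
          rw [norm_sub_rev]
          exact hK.norm_sub_le z p
      _ = K * (‖z - p‖ * ‖g z‖) * ‖f z‖ := by ring
      _ ≤ K * Q * ‖f z‖ := by gcongr; exact hgQ z hz
  have hparts := norm_setIntegral_dbar_mul_mul_conj_le (μ := μ) hD hφ hc hφ_nonneg hφ_nonpos hf
    hf_int hg hgB hgR
  calc ‖dφ p‖ * ‖∫ z in D, f z * conj (g z) ∂μ‖
      = ‖(∫ z in D, (dφ p - dφ z) * (f z * conj (g z)) ∂μ) +
          ∫ z in D, dφ z * (f z * conj (g z)) ∂μ‖ := by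
        simp only [sub_mul]
        rw [integral_sub (hF_int.const_mul _) hdφ_int, sub_add_cancel, integral_const_mul, norm_mul]
    _ ≤ K * Q * (∫ z in D, ‖f z‖ ∂μ) + 2 * R * ∫ z in D, ‖f z‖ ∂μ :=
        (norm_add_le _ _).trans (add_le_add hsing hparts)
    _ = (K * Q + 2 * R) * ∫ z in D, ‖f z‖ ∂μ := by ring

end WeightedPairing

theorem exists_sqrt_norm_mul_norm_log_le (A : ℝ) :
    ∃ Q, ∀ w : ℂ, ‖w‖ ≤ A → √‖w‖ * ‖Complex.log w‖ ≤ Q := by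
  have hcont : Continuous fun s : ℝ => 2 * |s * Real.log s| + s * Real.pi :=
    (continuous_const.mul Real.continuous_mul_log.abs).add (continuous_id.mul continuous_const)
  obtain ⟨Q, hQ⟩ := (isCompact_Icc (a := 0) (b := √A)).bddAbove_image hcont.continuousOn
  refine ⟨Q, fun w hw => ?_⟩
  set s := √‖w‖
  have hs : 0 ≤ s := Real.sqrt_nonneg _
  have hlog : Real.log ‖w‖ = 2 * Real.log s := by
    rw [Real.log_sqrt (norm_nonneg w), mul_div_cancel₀ _ two_ne_zero]
  calc s * ‖Complex.log w‖ ≤ s * (|Real.log ‖w‖| + Real.pi) := by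
        gcongr
        refine (Complex.norm_le_abs_re_add_abs_im _).trans ?_
        rw [Complex.log_re, Complex.log_im]
        gcongr
        exact Complex.abs_arg_le_pi w
    _ = 2 * |s * Real.log s| + s * Real.pi := by
        rw [hlog, abs_mul, abs_mul, abs_of_nonneg hs, abs_two]
        ring
    _ ≤ Q := hQ ⟨s, ⟨hs, Real.sqrt_le_sqrt hw⟩, rfl⟩

theorem exists_le_mul_sub_of_lipschitzWith {E : Type*} [NormedAddCommGroup E] [NormedSpace ℝ E]
    {D : Set E} {φ : E → ℝ} {K : NNReal} {l : E →L[ℝ] ℝ} {c : ℝ} (hφ : LipschitzWith K φ)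
    (hφ_nonpos : ∀ x ∉ D, φ x ≤ 0) (hl : l ≠ 0) (hlD : ∀ x ∈ D, l x < c) :
    ∃ C, 0 ≤ C ∧ ∀ x ∈ D, φ x ≤ C * (c - l x) := by
  obtain ⟨e, he⟩ : ∃ e, l e = 1 := LinearMap.surjective (f := (l : E →ₗ[ℝ] ℝ))
    (fun h => hl (ContinuousLinearMap.coe_injective h)) 1
  refine ⟨K * ‖e‖, by positivity, fun x hx => ?_⟩
  set t := c - l x
  have ht : 0 < t := sub_pos.2 (hlD x hx)
  have hout : x + t • e ∉ D := fun h => (hlD _ h).ne (by simp [he, t])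
  have hdist := hφ.dist_le_mul x (x + t • e)
  rw [dist_self_add_right, norm_smul, Real.norm_of_nonneg ht.le] at hdist
  calc φ x ≤ φ x - φ (x + t • e) := le_sub_self_iff _ |>.2 (hφ_nonpos _ hout)
    _ ≤ K * (t * ‖e‖) := (Real.sub_le_dist _ _).trans hdist
    _ = K * ‖e‖ * t := by ring

section LogFamily

variable {E : Type*} [NormedAddCommGroup E] [NormedSpace ℂ E] {D : Set E} {p z : E}
  {l : E →L[ℂ] ℂ} {δ : ℝ}

theorem re_pos_of_contact (hp : p ∉ D) (hl : ∀ z ∈ D, ‖z - p‖ ^ 2 ≤ (l (p - z)).re) (hz : z ∈ D) :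
    0 < (l (p - z)).re := by
  have hzp : z ≠ p := fun h => hp (h ▸ hz)
  exact (pow_pos (norm_pos_iff.2 (sub_ne_zero.2 hzp)) 2).trans_le (hl z hz)

theorem mem_slitPlane_add (hz : 0 < (l (p - z)).re) (hδ : 0 ≤ δ) :
    l (p - z) + δ ∈ Complex.slitPlane :=
  Or.inl (by simpa using add_pos_of_pos_of_nonneg hz hδ)

theorem hasFDerivAt_log_add (hz : 0 < (l (p - z)).re) (hδ : 0 ≤ δ) :
    HasFDerivAt (fun y => Complex.log (l (p - y) + δ)) ((l (p - z) + δ)⁻¹ • -l) z := by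
  have h : HasFDerivAt (fun y => l (p - y) + δ) (-l) z := by
    simpa using (l.hasFDerivAt.comp z ((hasFDerivAt_id z).const_sub p)).add_const (δ : ℂ)
  exact h.clog (mem_slitPlane_add hz hδ)

theorem exists_norm_sub_mul_norm_log_le (hD : Bornology.IsBounded D)
    (hl : ∀ z ∈ D, ‖z - p‖ ^ 2 ≤ (l (p - z)).re) :
    ∃ Q, ∀ δ : ℝ, 0 < δ → δ ≤ 1 → ∀ z ∈ D, ‖z - p‖ * ‖Complex.log (l (p - z) + δ)‖ ≤ Q ∧
      √δ * ‖Complex.log (l (p - z) + δ)‖ ≤ Q := by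
  obtain ⟨r, hr⟩ := hD.subset_closedBall p
  obtain ⟨Q, hQ⟩ := exists_sqrt_norm_mul_norm_log_le (‖l‖ * r + 1)
  refine ⟨Q, fun δ hδ hδ1 z hz => ?_⟩
  set u := l (p - z) + δ
  have hu : ‖u‖ ≤ ‖l‖ * r + 1 := by
    refine (norm_add_le _ _).trans (add_le_add ?_ (by simpa [abs_of_pos hδ] using hδ1))
    refine l.le_opNorm_of_le ?_
    rw [← dist_eq_norm, dist_comm]
    exact hr hz
  have hre : ‖z - p‖ ^ 2 + δ ≤ ‖u‖ :=
    (add_le_add_left (hl z hz) δ).trans (by simpa [u] using Complex.re_le_norm u)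
  constructor <;> refine le_trans ?_ (hQ u hu) <;> gcongr
  · exact Real.le_sqrt_of_sq_le (by linarith)
  · linarith [sq_nonneg ‖z - p‖]

theorem exists_mul_norm_fderiv_log_le {φ : E → ℝ} {K : NNReal} (hp : p ∉ D)
    (hl : ∀ z ∈ D, ‖z - p‖ ^ 2 ≤ (l (p - z)).re) (hφ : LipschitzWith K φ)
    (hφ_nonpos : ∀ x ∉ D, φ x ≤ 0) (v : E) :
    ∃ R, 0 ≤ R ∧ ∀ δ : ℝ, 0 ≤ δ → ∀ z ∈ D,
      φ z * ‖fderiv ℂ (fun y => Complex.log (l (p - y) + δ)) z v‖ ≤ R := by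
  rcases D.eq_empty_or_nonempty with rfl | ⟨z₀, hz₀⟩
  · exact ⟨0, le_rfl, by simp⟩
  set L : E →L[ℝ] ℝ := Complex.reCLM.comp (l.restrictScalars ℝ)
  have hLp : ∀ z, L p - L z = (l (p - z)).re := fun z => by simp [L]
  have hL : L ≠ 0 := fun h => (re_pos_of_contact hp hl hz₀).ne' (by rw [← hLp, h]; simp)
  obtain ⟨C, hC, hφC⟩ := exists_le_mul_sub_of_lipschitzWith hφ hφ_nonpos hL
    (fun z hz => sub_pos.1 ((re_pos_of_contact hp hl hz).trans_eq (hLp z).symm))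
  refine ⟨C * ‖l v‖, by positivity, fun δ hδ z hz => ?_⟩
  have hre := re_pos_of_contact hp hl hz
  set u := l (p - z) + δ
  have hu : (l (p - z)).re ≤ ‖u‖ :=
    (le_add_of_nonneg_right hδ).trans (by simpa [u] using Complex.re_le_norm u)
  have hu0 : 0 < ‖u‖ := hre.trans_le hu
  have hφu : φ z ≤ C * ‖u‖ := ((hφC z hz).trans_eq (by rw [hLp])).trans (by gcongr)
  rw [(hasFDerivAt_log_add hre hδ).fderiv]
  calc φ z * ‖((l (p - z) + δ)⁻¹ • -l) v‖ = φ z * (‖u‖⁻¹ * ‖l v‖) := by simp [u]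
    _ ≤ C * ‖u‖ * (‖u‖⁻¹ * ‖l v‖) := by gcongr
    _ = C * ‖l v‖ := by field_simp

end LogFamily

theorem exists_norm_setIntegral_mul_conj_log_le {E : Type*} [NormedAddCommGroup E]
    [NormedSpace ℂ E] [FiniteDimensional ℂ E] [MeasurableSpace E] [BorelSpace E] {μ : Measure E}
    [μ.IsAddHaarMeasure] {D : Set E} {p : E} {l : E →L[ℂ] ℂ} {φ : E → ℝ} (hD : IsOpen D)
    (hbdd : Bornology.IsBounded D) (hp : p ∉ D)
    (hl : ∀ z ∈ D, ‖z - p‖ ^ 2 ≤ (l (p - z)).re) (hφ : ContDiff ℝ 2 φ) (hc : HasCompactSupport φ)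
    (hφ_nonneg : ∀ x ∈ D, 0 ≤ φ x) (hφ_nonpos : ∀ x ∉ D, φ x ≤ 0) (hφp : fderiv ℝ φ p ≠ 0) :
    ∃ M, 0 ≤ M ∧ ∀ δ : ℝ, 0 < δ → δ ≤ 1 → ∀ f : E → ℂ, DifferentiableOn ℂ f D →
      IntegrableOn f D μ →
        ‖∫ z in D, f z * conj (Complex.log (l (p - z) + δ)) ∂μ‖ ≤ M * ∫ z in D, ‖f z‖ ∂μ := by
  have hφ1 : ContDiff ℝ 1 φ := hφ.of_le one_le_two
  obtain ⟨v, hv⟩ : ∃ v, fderiv ℝ φ p v ≠ 0 := by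
    contrapose! hφp
    exact ContinuousLinearMap.ext hφp
  have ha : dbar v (fun y => (φ y : ℂ)) p ≠ 0 := fun h => hv (by
    rw [← re_dbar_ofReal (hφ1.differentiable one_ne_zero p), h, Complex.zero_re])
  obtain ⟨K, hK⟩ := ContDiff.lipschitzWith_of_hasCompactSupport hc hφ1 one_ne_zero
  obtain ⟨K', hK'⟩ := ContDiff.lipschitzWith_of_hasCompactSupport
    (hasCompactSupport_dbar (hc.comp_left (g := fun t : ℝ => (t : ℂ)) Complex.ofReal_zero) v)
    (contDiff_dbar (n := 1) (Complex.ofRealCLM.contDiff.comp hφ) v) one_ne_zero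
  obtain ⟨Q, hQ⟩ := exists_norm_sub_mul_norm_log_le hbdd hl
  obtain ⟨R, hR0, hR⟩ := exists_mul_norm_fderiv_log_le hp hl hK hφ_nonpos v
  set a := ‖dbar v (fun y => (φ y : ℂ)) p‖
  have ha0 : 0 < a := norm_pos_iff.2 ha
  refine ⟨(K' * |Q| + 2 * R) / a, by positivity, fun δ hδ hδ1 f hf hf_int => ?_⟩
  have hmain := norm_dbar_mul_norm_setIntegral_mul_conj_le (μ := μ) hD hφ1 hc hφ_nonneg hφ_nonpos
    hK' hf hf_int
    (fun z hz => (hasFDerivAt_log_add (re_pos_of_contact hp hl hz)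
      hδ.le).differentiableAt.differentiableWithinAt)
    (fun z hz => (le_div_iff₀' (Real.sqrt_pos.2 hδ)).2 (hQ δ hδ hδ1 z hz).2)
    (fun z hz => (hQ δ hδ hδ1 z hz).1.trans (le_abs_self Q)) (hR δ hδ.le)
  rwa [div_mul_eq_mul_div, le_div_iff₀' ha0]

section SupportPoint

theorem norm_sub_sq_le_two_mul_re_inner {𝕜 F : Type*} [RCLike 𝕜] [NormedAddCommGroup F]
    [InnerProductSpace 𝕜 F] {x y : F} (h : ‖x‖ ≤ ‖y‖) :
    ‖x - y‖ ^ 2 ≤ 2 * RCLike.re (inner 𝕜 y (y - x)) := by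
  have hsq : ‖x‖ ^ 2 ≤ ‖y‖ ^ 2 := by gcongr
  rw [@norm_sub_sq 𝕜, inner_re_symm, inner_sub_right, map_sub, inner_self_eq_norm_sq]
  linarith

theorem exists_mem_closure_norm_sub_sq_le_re {ι : Type*} [Fintype ι] {D : Set (ι → ℂ)}
    (hne : D.Nonempty) (hbdd : Bornology.IsBounded D) :
    ∃ p ∈ closure D, ∃ l : (ι → ℂ) →L[ℂ] ℂ, ∀ z ∈ D, ‖z - p‖ ^ 2 ≤ (l (p - z)).re := by
  set e : (ι → ℂ) ≃L[ℂ] EuclideanSpace ℂ ι := (PiLp.continuousLinearEquiv 2 ℂ fun _ => ℂ).symm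
  obtain ⟨p, hp, hmax⟩ := hbdd.isCompact_closure.exists_isMaxOn hne.closure
    e.continuous.norm.continuousOn
  refine ⟨p, hp, (2 : ℂ) • (innerSL ℂ (e p)).comp (e : (ι → ℂ) →L[ℂ] EuclideanSpace ℂ ι),
    fun z hz => ?_⟩
  have hsup : ‖z - p‖ ≤ ‖e z - e p‖ := by
    rw [← map_sub]
    refine (pi_norm_le_iff_of_nonneg (norm_nonneg _)).2 fun i => ?_
    exact PiLp.norm_apply_le (e (z - p)) i
  calc ‖z - p‖ ^ 2 ≤ ‖e z - e p‖ ^ 2 := by gcongr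
    _ ≤ 2 * RCLike.re (inner ℂ (e p) (e p - e z)) :=
        norm_sub_sq_le_two_mul_re_inner (hmax (subset_closure hz))
    _ = _ := by simp [Complex.mul_re, inner_sub_right]

theorem notMem_of_forall_norm_sub_sq_le_re {E : Type*} [NormedAddCommGroup E] [NormedSpace ℂ E]
    [Nontrivial E] {D : Set E} {p : E} {l : E →L[ℂ] ℂ} (hD : IsOpen D)
    (hl : ∀ z ∈ D, ‖z - p‖ ^ 2 ≤ (l (p - z)).re) : p ∉ D := by
  intro hp
  have : (𝓝[≠] (0 : E)).NeBot := Module.punctured_nhds_neBot ℂ E 0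
  have hadd : ∀ᶠ v in 𝓝 (0 : E), p + v ∈ D :=
    (continuous_const.add continuous_id).continuousAt.eventually (hD.mem_nhds (by simpa using hp))
  have hsub : ∀ᶠ v in 𝓝 (0 : E), p - v ∈ D :=
    (continuous_const.sub continuous_id).continuousAt.eventually (hD.mem_nhds (by simpa using hp))
  obtain ⟨v, ⟨hv_add, hv_sub⟩, hv⟩ :=
    (((hadd.and hsub).filter_mono nhdsWithin_le_nhds).and
      (eventually_mem_nhdsWithin (s := {0}ᶜ) (a := 0))).exists
  have h1 : ‖v‖ ^ 2 ≤ -(l v).re := by simpa using hl _ hv_add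
  have h2 : ‖v‖ ^ 2 ≤ (l v).re := by simpa using hl _ hv_sub
  have hpos : 0 < ‖v‖ ^ 2 := pow_pos (norm_pos_iff.2 hv) 2
  linarith

end SupportPoint

section DefiningFunction

variable {E : Type*} {D V : Set E} {ρ : E → ℝ} {p : E}

theorem neg_iff_mem_of_inter_eq (hDρ : D ∩ V = {z ∈ V | ρ z < 0}) {z : E} (hz : z ∈ V) :
    ρ z < 0 ↔ z ∈ D :=
  ⟨fun h => (hDρ.ge ⟨hz, h⟩).1, fun h => (hDρ.le ⟨h, hz⟩).2⟩

theorem eq_zero_of_mem_frontier_of_inter_eq [TopologicalSpace E] (hD : IsOpen D)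
    (hDρ : D ∩ V = {z ∈ V | ρ z < 0}) (hp : p ∈ frontier D) (hpV : V ∈ 𝓝 p)
    (hρ : ContinuousAt ρ p) : ρ p = 0 := by
  rw [hD.frontier_eq] at hp
  refine le_antisymm (le_of_tendsto_of_frequently hρ.tendsto ?_)
    (not_lt.1 fun h => hp.2 ((neg_iff_mem_of_inter_eq hDρ (mem_of_mem_nhds hpV)).1 h))
  exact ((mem_closure_iff_frequently.1 hp.1).and_eventually hpV).mono
    fun x hx => ((neg_iff_mem_of_inter_eq hDρ hx.2).2 hx.1).le

theorem exists_contDiff_hasCompactSupport_of_inter_eq [NormedAddCommGroup E] [NormedSpace ℝ E]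
    [FiniteDimensional ℝ E] {n : ℕ∞} (hD : IsOpen D) (hV : IsOpen V) (hρ : ContDiffOn ℝ n ρ V)
    (hDρ : D ∩ V = {z ∈ V | ρ z < 0}) (hp : p ∈ frontier D) (hpV : p ∈ V)
    (hdρ : fderiv ℝ ρ p ≠ 0) :
    ∃ φ : E → ℝ, ContDiff ℝ n φ ∧ HasCompactSupport φ ∧ (∀ x ∈ D, 0 ≤ φ x) ∧
      (∀ x ∉ D, φ x ≤ 0) ∧ fderiv ℝ φ p ≠ 0 := by
  have hρ_diff : DifferentiableAt ℝ ρ p := by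
    contrapose! hdρ
    exact fderiv_zero_of_not_differentiableAt hdρ
  have hρp : ρ p = 0 :=
    eq_zero_of_mem_frontier_of_inter_eq hD hDρ hp (hV.mem_nhds hpV) hρ_diff.continuousAt
  obtain ⟨b, hbV, hbc, hb, hb01, hbp⟩ :=
    exists_contDiff_tsupport_subset (n := ⊤) (hV.mem_nhds hpV)
  have hb0 : ∀ x, 0 ≤ b x := fun x => (hb01 ⟨x, rfl⟩).1
  have hb_out : ∀ x ∉ V, b x = 0 := fun x hx => image_eq_zero_of_notMem_tsupport fun h => hx (hbV h)
  have hbρ : ContDiff ℝ n fun x => b x * ρ x := by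
    refine contMDiff_iff_contDiff.1 (contMDiff_of_tsupport fun x hx => ?_)
    exact ((hb.of_le (mod_cast le_top)).contDiffAt.mul (hρ.contDiffAt
      (hV.mem_nhds (hbV (tsupport_mul_subset_left hx))))).contMDiffAt
  refine ⟨fun x => -(b x * ρ x), hbρ.neg, hbc.mul_right.neg, fun x hx => ?_, fun x hx => ?_, ?_⟩
  · by_cases hxV : x ∈ V
    · have hneg := (neg_iff_mem_of_inter_eq hDρ hxV).2 hx
      exact neg_nonneg.2 (mul_nonpos_of_nonneg_of_nonpos (hb0 x) hneg.le)
    · simp [hb_out x hxV]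
  · by_cases hxV : x ∈ V
    · have hnonneg := not_lt.1 fun h => hx ((neg_iff_mem_of_inter_eq hDρ hxV).1 h)
      exact neg_nonpos.2 (mul_nonneg (hb0 x) hnonneg)
    · simp [hb_out x hxV]
  · have hb_diff : DifferentiableAt ℝ b p := hb.differentiable (by simp) p
    rw [fderiv_fun_neg, fderiv_fun_mul hb_diff hρ_diff, hbp, hρp]
    simpa using hdρ

end DefiningFunction

section Duality

variable {X : Type*} [MeasurableSpace X] {μ : Measure X} [IsFiniteMeasure μ]

theorem integral_norm_apply_indicatorConstLp_le {P : Lp ℂ 2 μ →L[ℂ] Lp ℂ 2 μ} {C : NNReal}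
    (hP : ∀ f : Lp ℂ 2 μ, MemLp f 1 μ → eLpNorm (P f) 1 μ ≤ C * eLpNorm f 1 μ) {s : Set X}
    (hs : MeasurableSet s) :
    ∫ x, ‖P (indicatorConstLp 2 hs (measure_ne_top μ s) 1) x‖ ∂μ ≤ C * μ.real s := by
  have h := hP (indicatorConstLp 2 hs (measure_ne_top μ s) 1)
    ((Lp.memLp _).mono_exponent one_le_two)
  rw [eLpNorm_congr_ae indicatorConstLp_coeFn, eLpNorm_indicator_const hs one_ne_zero
    ENNReal.one_ne_top, eLpNorm_one_eq_lintegral_enorm] at h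
  rw [integral_norm_eq_lintegral_enorm (Lp.aestronglyMeasurable _)]
  simpa [Measure.real] using ENNReal.toReal_mono (by finiteness) h

theorem exists_ae_neg_re_le_of_isBoundedOnLp_one {K : Submodule ℂ (Lp ℂ 2 μ)}
    [K.HasOrthogonalProjection] (hK : IsBoundedOnLp K.starProjection 1) :
    ∃ C : NNReal, ∀ g ∈ K, ∀ M, 0 ≤ M →
      (∀ f ∈ K, ‖∫ x, f x * conj (g x) ∂μ‖ ≤ M * ∫ x, ‖f x‖ ∂μ) →
        ∀ᵐ x ∂μ, -(g x).re ≤ M * C := by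
  obtain ⟨C, hC⟩ := hK
  refine ⟨C, fun g hg M hM hgM => ?_⟩
  have hg_int : Integrable g μ := memLp_one_iff_integrable.1
    ((Lp.memLp g).mono_exponent one_le_two)
  refine ae_le_of_forall_setIntegral_le hg_int.re.neg (integrable_const _) fun s hs _ => ?_
  set χ : Lp ℂ 2 μ := indicatorConstLp 2 hs (measure_ne_top μ s) 1
  have hpairing : ∫ x in s, g x ∂μ = conj (∫ x, K.starProjection χ x * conj (g x) ∂μ) := by
    have horth : inner ℂ χ g = inner ℂ (K.starProjection χ) g := by
      rw [← sub_eq_zero, ← inner_sub_left, K.starProjection_inner_eq_zero χ g hg]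
    rw [← L2.inner_indicatorConstLp_one hs (measure_ne_top μ s), horth, L2.inner_def,
      ← integral_conj]
    simp [RCLike.inner_apply, mul_comm]
  calc ∫ x in s, -(g x).re ∂μ = -(∫ x in s, g x ∂μ).re := by
        rw [integral_neg]
        exact congrArg Neg.neg (integral_re hg_int.integrableOn)
    _ ≤ ‖∫ x in s, g x ∂μ‖ := (neg_le_abs _).trans (Complex.abs_re_le_norm _)
    _ ≤ M * ∫ x, ‖K.starProjection χ x‖ ∂μ := by
        rw [hpairing, RCLike.norm_conj]
        exact hgM _ (K.starProjection_apply_mem χ)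
    _ ≤ M * (C * μ.real s) := by
        gcongr
        exact integral_norm_apply_indicatorConstLp_le hC hs
    _ = ∫ _ in s, M * C ∂μ := by
        rw [setIntegral_const, smul_eq_mul]
        ring

end Duality

theorem forall_mem_le_of_ae_restrict_le {X : Type*} [TopologicalSpace X] [MeasurableSpace X]
    [OpensMeasurableSpace X] {μ : Measure X} [μ.IsOpenPosMeasure] {U : Set X} {f : X → ℝ} {T : ℝ}
    (hU : IsOpen U) (hf : ContinuousOn f U) (h : ∀ᵐ x ∂μ.restrict U, f x ≤ T) :
    ∀ x ∈ U, f x ≤ T := by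
  intro x hx
  have hmax := Measure.eqOn_open_of_ae_eq (μ := μ) (h.mono fun y hy => max_eq_right hy) hU
    (hf.sup continuousOn_const) continuousOn_const hx
  exact max_eq_right_iff.1 hmax

theorem not_forall_neg_re_log_le {E : Type*} [NormedAddCommGroup E] [NormedSpace ℂ E] {D : Set E}
    {p : E} {l : E →L[ℂ] ℂ} (hp : p ∈ closure D) (hl : ∀ z ∈ D, 0 < (l (p - z)).re) (T : ℝ) :
    ¬ ∀ δ : ℝ, 0 < δ → δ ≤ 1 → ∀ z ∈ D, -(Complex.log (l (p - z) + δ)).re ≤ T := by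
  intro h
  have hδ : ∀ δ : ℝ, 0 < δ → δ ≤ 1 → ∀ z ∈ D, Real.exp (-T) ≤ ‖l (p - z) + δ‖ := by
    intro δ hδ hδ1 z hz
    have hpos : 0 < ‖l (p - z) + δ‖ := norm_pos_iff.2
      (Complex.slitPlane_ne_zero (mem_slitPlane_add (hl z hz) hδ.le))
    rw [← Real.le_log_iff_exp_le hpos, ← Complex.log_re]
    linarith [h δ hδ hδ1 z hz]
  have h0 : ∀ z ∈ D, Real.exp (-T) ≤ ‖l (p - z)‖ := by
    intro z hz
    have hlim : Tendsto (fun δ : ℝ => ‖l (p - z) + δ‖) (𝓝[>] 0) (𝓝 ‖l (p - z)‖) := by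
      have hcont : Continuous fun δ : ℝ => ‖l (p - z) + δ‖ := by fun_prop
      simpa using (hcont.tendsto 0).mono_left nhdsWithin_le_nhds
    refine ge_of_tendsto hlim ?_
    filter_upwards [Ioc_mem_nhdsGT one_pos] with δ hδ' using hδ δ hδ'.1 hδ'.2 z hz
  have hclosed : IsClosed {z | Real.exp (-T) ≤ ‖l (p - z)‖} :=
    isClosed_le continuous_const (by fun_prop)
  have hexp : Real.exp (-T) ≤ ‖l (p - p)‖ := closure_minimal h0 hclosed hp
  rw [sub_self, map_zero, norm_zero] at hexp
  exact hexp.not_gt (Real.exp_pos _)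

section BergmanProjection

variable {n : ℕ} {D : Opens (Fin n → ℂ)}

theorem exists_mem_bergmanSpace_ae_eq {g : (Fin n → ℂ) → ℂ} {B : ℝ}
    [IsFiniteMeasure (volume.restrict (D : Set (Fin n → ℂ)))] (hg : DifferentiableOn ℂ g D)
    (hgB : ∀ z ∈ D, ‖g z‖ ≤ B) :
    ∃ G ∈ bergmanSpace D, G =ᵐ[volume.restrict (D : Set (Fin n → ℂ))] g := by
  have hmem : MemLp g 2 (volume.restrict (D : Set (Fin n → ℂ))) :=
    MemLp.of_bound (hg.continuousOn.aestronglyMeasurable D.isOpen.measurableSet) B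
      ((ae_restrict_mem D.isOpen.measurableSet).mono hgB)
  exact ⟨hmem.toLp g, ⟨g, hg, hmem.coeFn_toLp⟩, hmem.coeFn_toLp⟩

theorem exists_neg_re_le_of_isBoundedOnLp_one
    (hbdd : Bornology.IsBounded (D : Set (Fin n → ℂ)))
    (hB : IsBoundedOnLp (bergmanProjection D) 1) :
    ∃ C : NNReal, ∀ g : (Fin n → ℂ) → ℂ, DifferentiableOn ℂ g D → ∀ B M : ℝ, 0 ≤ M →
      (∀ z ∈ D, ‖g z‖ ≤ B) →
      (∀ f, DifferentiableOn ℂ f D → IntegrableOn f (D : Set (Fin n → ℂ)) →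
        ‖∫ z in D, f z * conj (g z)‖ ≤ M * ∫ z in D, ‖f z‖) →
      ∀ z ∈ D, -(g z).re ≤ M * C := by
  have : IsFiniteMeasure (volume.restrict (D : Set (Fin n → ℂ))) :=
    isFiniteMeasure_restrict.2 hbdd.measure_lt_top.ne
  obtain ⟨C, hC⟩ := exists_ae_neg_re_le_of_isBoundedOnLp_one hB
  refine ⟨C, fun g hg B M hM hgB hgM => ?_⟩
  obtain ⟨G, hG, hGg⟩ := exists_mem_bergmanSpace_ae_eq hg hgB
  refine forall_mem_le_of_ae_restrict_le (μ := volume) D.isOpen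
    (Complex.continuous_re.comp_continuousOn hg.continuousOn).neg ?_
  have hpairing : ∀ F ∈ bergmanSpace D, ‖∫ z in D, F z * conj (G z)‖ ≤ M * ∫ z in D, ‖F z‖ := by
    rintro F ⟨f, hf, hFf⟩
    have hF_int := memLp_one_iff_integrable.1 ((Lp.memLp F).mono_exponent one_le_two)
    calc ‖∫ z in D, F z * conj (G z)‖ = ‖∫ z in D, f z * conj (g z)‖ :=
          congrArg norm (integral_congr_ae (hFf.fun_mul (hGg.fun_comp conj)))
      _ ≤ M * ∫ z in D, ‖f z‖ := hgM f hf (hF_int.congr hFf)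
      _ = M * ∫ z in D, ‖F z‖ := congrArg (M * ·) (integral_congr_ae (hFf.fun_comp norm)).symm
  filter_upwards [hC G hG M hM hpairing, hGg] with z hz hzg
  rwa [← hzg]

theorem not_isBoundedOnLp_one_bergmanProjection {p : Fin n → ℂ} {l : (Fin n → ℂ) →L[ℂ] ℂ}
    {φ : (Fin n → ℂ) → ℝ}
    (hbdd : Bornology.IsBounded (D : Set (Fin n → ℂ))) (hp : p ∈ frontier (D : Set (Fin n → ℂ)))
    (hl : ∀ z ∈ D, ‖z - p‖ ^ 2 ≤ (l (p - z)).re) (hφ : ContDiff ℝ 2 φ)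
    (hc : HasCompactSupport φ) (hφ_nonneg : ∀ x ∈ D, 0 ≤ φ x) (hφ_nonpos : ∀ x ∉ D, φ x ≤ 0)
    (hφp : fderiv ℝ φ p ≠ 0) : ¬ IsBoundedOnLp (bergmanProjection D) 1 := by
  intro hB
  rw [D.isOpen.frontier_eq] at hp
  obtain ⟨C, hC⟩ := exists_neg_re_le_of_isBoundedOnLp_one hbdd hB
  obtain ⟨M, hM, hpairing⟩ := exists_norm_setIntegral_mul_conj_log_le (μ := volume) D.isOpen hbdd
    hp.2 hl hφ hc hφ_nonneg hφ_nonpos hφp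
  obtain ⟨Q, hQ⟩ := exists_norm_sub_mul_norm_log_le hbdd hl
  have hre : ∀ z ∈ D, 0 < (l (p - z)).re := fun z hz => re_pos_of_contact hp.2 hl hz
  refine not_forall_neg_re_log_le hp.1 hre (M * C) fun δ hδ hδ1 => ?_
  refine hC _ (fun z hz => ?_) (Q / √δ) M hM (fun z hz => ?_) (hpairing δ hδ hδ1)
  · exact (hasFDerivAt_log_add (hre z hz) hδ.le).differentiableAt.differentiableWithinAt
  · exact (le_div_iff₀' (Real.sqrt_pos.2 hδ)).2 (hQ δ hδ hδ1 z hz).2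

end BergmanProjection

end Bergman

theorem mainTheorem6_general {n : ℕ} (hn : 1 ≤ n) (D : TopologicalSpace.Opens (Fin n → ℂ))
    (hne : (D : Set (Fin n → ℂ)).Nonempty) (hbdd : Bornology.IsBounded (D : Set (Fin n → ℂ)))
    {V : Set (Fin n → ℂ)} {ρ : (Fin n → ℂ) → ℝ} (hV : IsOpen V)
    (hDV : frontier (D : Set (Fin n → ℂ)) ⊆ V) (hρ : ContDiffOn ℝ 2 ρ V)
    (hdρ : ∀ z ∈ frontier (D : Set (Fin n → ℂ)), fderiv ℝ ρ z ≠ 0)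
    (hDρ : (D : Set (Fin n → ℂ)) ∩ V = {z ∈ V | ρ z < 0}) :
    ¬ Bergman.IsBoundedOnLp (Bergman.bergmanProjection D) 1 := by
  have : Nonempty (Fin n) := ⟨⟨0, hn⟩⟩
  obtain ⟨p, hp, l, hl⟩ := Bergman.exists_mem_closure_norm_sub_sq_le_re hne hbdd
  have hpD : p ∈ frontier (D : Set (Fin n → ℂ)) := by
    rw [D.isOpen.frontier_eq]
    exact ⟨hp, Bergman.notMem_of_forall_norm_sub_sq_le_re D.isOpen hl⟩
  obtain ⟨φ, hφ, hc, hφ_nonneg, hφ_nonpos, hφp⟩ :=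
    Bergman.exists_contDiff_hasCompactSupport_of_inter_eq (n := 2) D.isOpen hV hρ hDρ hpD (hDV hpD)
      (hdρ p hpD)
  exact Bergman.not_isBoundedOnLp_one_bergmanProjection hbdd hpD hl hφ hc hφ_nonneg hφ_nonpos hφp

theorem mainTheorem6 {n : ℕ} (hn : 1 ≤ n) (D : TopologicalSpace.Opens (Fin n → ℂ))
    (hconn : IsConnected (D : Set (Fin n → ℂ)))
    (hbdd : Bornology.IsBounded (D : Set (Fin n → ℂ)))
    (hsmooth : Bergman.IsSmoothlyBounded (D : Set (Fin n → ℂ))) :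
    ¬ Bergman.IsBoundedOnLp (Bergman.bergmanProjection D) 1 := by
  obtain ⟨V, ρ, hV, hDV, hρ, hdρ, hDρ⟩ := hsmooth
  exact mainTheorem6_general hn D hconn.nonempty hbdd hV hDV (hρ.of_le ENat.LEInfty.out) hdρ hDρ
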